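/- Let $\mathbb{H}$ be the quaternions, $\mathbb{B}=\{q\in\mathbb{H} : |q|<1\}$ and $\mathbb{S}=\{I\in\mathbb{H} : I^2=-1\}$. A function $f:\mathbb{B}\to\mathbb{H}$ is called slice regular if, for every $I\in\mathbb{S}$, the restriction $f_I$ of $f$ to $\mathbb{B}\cap(\mathbb{R}+I\mathbb{R})$ is (real) differentiable and satisfies $$\frac12\left(\frac{\partial}{\partial x}+I\frac{\partial}{\partial y}\right)f_I(x+Iy)=0$$ at all points $x+Iy\in\mathbb{B}$ with $x,y\in\mathbb{R}$. Theorem. Let $f:\mathbb{B}\to\mathbb{B}$ be a slice regular function and suppose that $f$ has a fixed point $q_0\in\mathbb{B}$. Then either $f$ is the identity function of $\mathbb{B}$, or $f$ has no other fixed point in $\mathbb{B}$. -/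

import Mathlib

noncomputable section

namespace SliceRegular

/-- The `2`-sphere `𝕊 = {q ∈ ℍ | q² = -1}` of imaginary units. -/
def imaginaryUnits : Set (Quaternion ℝ) := {q | q ^ 2 = -1}

/-- The open unit ball `𝔹 = {q ∈ ℍ | ‖q‖ < 1}` of the quaternions. -/
def unitBall : Set (Quaternion ℝ) := {q | ‖q‖ < 1}

/-- The parametrization `x + i y ↦ x + I y` of the slice `L_I = ℝ + I ℝ` by the plane `ℂ`. -/
def sliceMap (I : Quaternion ℝ) (z : ℂ) : Quaternion ℝ :=
  (z.re : Quaternion ℝ) + I * (z.im : Quaternion ℝ)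

/-- `∂̄_I f (x + I y) = (1/2) (∂/∂x + I ∂/∂y) f_I (x + I y)`, with `z = x + i y`: the partial
derivatives are the values of the real differential of `f_I` at the vectors `1` and `i`. -/
def dbar (I : Quaternion ℝ) (f : Quaternion ℝ → Quaternion ℝ) (z : ℂ) : Quaternion ℝ :=
  (1 / 2 : ℝ) • (fderiv ℝ (fun w : ℂ => f (sliceMap I w)) z 1
    + I * fderiv ℝ (fun w : ℂ => f (sliceMap I w)) z Complex.I)

/-- Slice regularity of `f` on an open set `Ω ⊆ ℍ`: for every imaginary unit `I`, the restriction
of `f` to `Ω ∩ L_I` is real differentiable and `∂̄_I f` vanishes identically there. Only the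
values of `f` on `Ω` matter. -/
def IsSliceRegularOn (f : Quaternion ℝ → Quaternion ℝ) (Ω : Set (Quaternion ℝ)) : Prop :=
  ∀ I ∈ imaginaryUnits, ∀ z : ℂ, sliceMap I z ∈ Ω →
    DifferentiableAt ℝ (fun w : ℂ => f (sliceMap I w)) z ∧ dbar I f z = 0

end SliceRegular

end

open scoped Quaternion
open Finset Filter Topology

namespace SliceRegular

/-! On the ball `f` is a power series `∑ qⁿ aₙ` (`IsSliceRegularOn.exists_hasSum`), and `‖f‖ ≤ 1`
makes the regular product `u ↦ conv a u` a contraction of ℓ² (`sum_norm_sq_conv_le`), as for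
multipliers of the Hardy space. Let `p ≠ q` be fixed and let `h n = star (p ^ n - q ^ n)`, the
difference of two Szegő kernels. Since `h 0 = 0`, `h` is the shift of a sequence `u` of the same
norm. The product evaluates at `p` to `∑ p ^ m * f p * u m` (`hasSum_pow_mul_conv`), so the two
fixed points give `⟨h, conv a u⟩ = ‖u‖² = ‖h‖²`. With the contraction this is equality in
Cauchy–Schwarz, so `conv a u = h`, that is `a * u = X * u` as power series. Cancelling `u ≠ 0`
leaves `a = X`, so `f` is the identity. -/

/-! ### Imaginary units and slices. -/

theorem norm_of_mem_imaginaryUnits {I : ℍ[ℝ]} (hI : I ∈ imaginaryUnits) : ‖I‖ = 1 := by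
  have h : I ^ 2 = -1 := hI
  have h2 : ‖I‖ ^ 2 = 1 := by rw [← norm_pow, h, norm_neg, norm_one]
  exact (pow_eq_one_iff_of_nonneg (norm_nonneg I) two_ne_zero).1 h2

theorem star_of_mem_imaginaryUnits {I : ℍ[ℝ]} (hI : I ∈ imaginaryUnits) : star I = -I := by
  have h : I ^ 2 = -1 := hI
  have h1 : I * star I = 1 := by
    rw [Quaternion.self_mul_star, Quaternion.normSq_eq_norm_mul_self,
      norm_of_mem_imaginaryUnits hI]
    simp
  have h2 : I * (-I) = 1 := by rw [mul_neg, ← sq, h, neg_neg]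
  have h0 : I ≠ 0 := by rintro rfl; simp at h1
  exact mul_left_cancel₀ h0 (h1.trans h2.symm)

theorem mem_imaginaryUnits_of_re_eq_zero {I : ℍ[ℝ]} (h : I.re = 0) (h1 : ‖I‖ = 1) :
    I ∈ imaginaryUnits := by
  have h2 : star I = -I := by ext <;> simp [h]
  have h3 := Quaternion.self_mul_star I
  rw [Quaternion.normSq_eq_norm_mul_self, h1, h2] at h3
  change I ^ 2 = -1
  rw [sq, ← neg_neg (I * I), ← mul_neg, h3]
  simp

theorem exists_imaginaryUnit_norm_smul_eq {w : ℍ[ℝ]} (h : w.re = 0) :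
    ∃ I ∈ imaginaryUnits, w = ‖w‖ • I := by
  by_cases hw : w = 0
  · obtain ⟨J, hre, hJ⟩ : ∃ J : ℍ[ℝ], J.re = 0 ∧ Quaternion.normSq J = 1 :=
      ⟨⟨0, 1, 0, 0⟩, rfl, (Quaternion.normSq_def' _).trans (by norm_num)⟩
    refine ⟨J, mem_imaginaryUnits_of_re_eq_zero hre ?_, by rw [hw, norm_zero, zero_smul]⟩
    rw [Quaternion.normSq_eq_norm_mul_self, ← sq] at hJ
    exact (pow_eq_one_iff_of_nonneg (norm_nonneg J) two_ne_zero).1 hJ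
  · have hn : ‖w‖ ≠ 0 := norm_ne_zero_iff.2 hw
    refine ⟨‖w‖⁻¹ • w, mem_imaginaryUnits_of_re_eq_zero (by simp [h]) ?_, ?_⟩
    · rw [norm_smul, norm_inv, norm_norm, inv_mul_cancel₀ hn]
    · rw [smul_smul, mul_inv_cancel₀ hn, one_smul]

theorem exists_sliceMap_eq (q : ℍ[ℝ]) : ∃ I ∈ imaginaryUnits, ∃ z : ℂ, sliceMap I z = q := by
  obtain ⟨I, hI, h⟩ := exists_imaginaryUnit_norm_smul_eq (w := q.im) (by simp)
  refine ⟨I, hI, ⟨q.re, ‖q.im‖⟩, ?_⟩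
  have h2 : I * ((‖q.im‖ : ℝ) : ℍ[ℝ]) = q.im := by
    rw [Quaternion.mul_coe_eq_smul, ← h]
  simp only [sliceMap, h2, Quaternion.re_add_im]

/-- The parametrization of the slice `ℝ + Iℝ` as a homomorphism of algebras. -/
def sliceHom {I : ℍ[ℝ]} (hI : I ∈ imaginaryUnits) : ℂ →ₐ[ℝ] ℍ[ℝ] :=
  Complex.liftAux I (by rw [← sq]; exact hI)

theorem sliceHom_apply {I : ℍ[ℝ]} (hI : I ∈ imaginaryUnits) (z : ℂ) :
    sliceHom hI z = sliceMap I z := by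
  rw [sliceHom, Complex.liftAux_apply, sliceMap, Quaternion.mul_coe_eq_smul]
  rfl

theorem norm_sliceHom {I : ℍ[ℝ]} (hI : I ∈ imaginaryUnits) (z : ℂ) : ‖sliceHom hI z‖ = ‖z‖ := by
  have h : sliceHom hI z * star (sliceHom hI z) = ((z.re ^ 2 + z.im ^ 2 : ℝ) : ℍ[ℝ]) := by
    have h2 : star (sliceHom hI z) = sliceHom hI (star z) := by
      simp only [sliceHom_apply, sliceMap, star_add, star_mul, star_of_mem_imaginaryUnits hI,
        Quaternion.star_coe]
      rw [Quaternion.coe_mul_eq_smul, Quaternion.mul_coe_eq_smul]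
      simp
    rw [h2, ← map_mul, show z * star z = ((z.re ^ 2 + z.im ^ 2 : ℝ) : ℂ) by
      simpa [Complex.normSq_apply, sq] using Complex.mul_conj z]
    exact (sliceHom hI).commutes _
  rw [Quaternion.self_mul_star, Quaternion.coe_inj, Quaternion.normSq_eq_norm_mul_self] at h
  have h3 : ‖z‖ ^ 2 = z.re ^ 2 + z.im ^ 2 := by
    rw [← Complex.normSq_eq_norm_sq, Complex.normSq_apply]; ring
  refine (pow_left_inj₀ (norm_nonneg _) (norm_nonneg _) two_ne_zero).1 ?_
  rw [h3, ← h, sq]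

/-! ### Power series expansion. -/

/-- The complex normed space structure on `ℍ` in which `i` acts as left multiplication by `I`. -/
@[reducible] noncomputable def sliceNormedSpace {I : ℍ[ℝ]} (hI : I ∈ imaginaryUnits) :
    NormedSpace ℂ ℍ[ℝ] :=
  { Module.compHom ℍ[ℝ] (sliceHom hI : ℂ →ₐ[ℝ] ℍ[ℝ]).toRingHom with
    norm_smul_le := fun z q => by
      change ‖sliceHom hI z * q‖ ≤ ‖z‖ * ‖q‖
      rw [norm_mul, norm_sliceHom] }

/-- When `i` acts on `ℍ` as left multiplication by `I`, `dbar I f = 0` is the Cauchy–Riemann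
equation; the series is the Taylor series of a holomorphic function. -/
theorem exists_hasSum_slice {f : ℍ[ℝ] → ℍ[ℝ]} (hf : IsSliceRegularOn f unitBall)
    {I : ℍ[ℝ]} (hI : I ∈ imaginaryUnits) :
    ∃ a : ℕ → ℍ[ℝ], ∀ z : ℂ, ‖z‖ < 1 →
      HasSum (fun n => sliceMap I z ^ n * a n) (f (sliceMap I z)) := by
  let _ := sliceNormedSpace hI
  have hsmul : ∀ (z : ℂ) (q : ℍ[ℝ]), z • q = sliceHom hI z * q := fun _ _ => rfl
  have : IsScalarTower ℝ ℂ ℍ[ℝ] := ⟨fun r z q => by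
    rw [hsmul, hsmul, map_smul, smul_mul_assoc]⟩
  have hd : DifferentiableOn ℂ (fun w : ℂ => f (sliceMap I w)) (Metric.ball 0 1) := by
    intro z hz
    have hz1 : sliceMap I z ∈ unitBall := by
      rw [← sliceHom_apply hI]
      simpa [unitBall, norm_sliceHom] using hz
    obtain ⟨h1, h2⟩ := hf I hI z hz1
    set D := fderiv ℝ (fun w : ℂ => f (sliceMap I w)) z with hD
    have h3 : D 1 + I * D Complex.I = 0 := by
      have : (1 / 2 : ℝ) • (D 1 + I * D Complex.I) = 0 := h2
      exact (smul_eq_zero.1 this).resolve_left (by norm_num)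
    have hII : I * I = -1 := by rw [← sq]; exact hI
    have h4 : D Complex.I = I * D 1 := by
      have : D 1 = - (I * D Complex.I) := eq_neg_of_add_eq_zero_left h3
      rw [this, mul_neg, ← mul_assoc, hII]; simp
    have h5 : HasFDerivAt (𝕜 := ℂ) (fun w : ℂ => f (sliceMap I w))
        (ContinuousLinearMap.toSpanSingleton ℂ (D 1)) z := by
      refine hasFDerivAt_of_restrictScalars ℝ h1.hasFDerivAt ?_
      refine ContinuousLinearMap.ext fun w => ?_
      change w • D 1 = D w
      rw [hsmul, sliceHom_apply, sliceMap, add_mul, Quaternion.coe_mul_eq_smul,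
        Quaternion.mul_coe_eq_smul, smul_mul_assoc, ← h4, ← map_smul, ← map_smul, ← map_add]
      congr 1
      apply Complex.ext <;> simp
    exact h5.differentiableAt.differentiableWithinAt
  refine ⟨fun n => ((n.factorial : ℂ)⁻¹) • iteratedDeriv n (fun w : ℂ => f (sliceMap I w)) 0,
    fun z hz => ?_⟩
  have h := Complex.hasSum_taylorSeries_on_ball hd (z := z) (by simpa using hz)
  have e : (fun n : ℕ => ((n.factorial : ℂ)⁻¹) • (z - 0) ^ n •
      iteratedDeriv n (fun w : ℂ => f (sliceMap I w)) 0) = fun n => sliceMap I z ^ n *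
      (((n.factorial : ℂ)⁻¹) • iteratedDeriv n (fun w : ℂ => f (sliceMap I w)) 0) := by
    funext n
    rw [smul_comm, sub_zero, hsmul (z ^ n), map_pow, sliceHom_apply]
  rw [e] at h
  exact h

/-- All slices share the real diameter, so the slice expansions have the same coefficients. -/
theorem coeff_unique {a b : ℕ → ℍ[ℝ]} {g : ℝ → ℍ[ℝ]}
    (ha : ∀ x : ℝ, |x| < 1 → HasSum (fun n => x ^ n • a n) (g x))
    (hb : ∀ x : ℝ, |x| < 1 → HasSum (fun n => x ^ n • b n) (g x)) : a = b := by
  have key : ∀ c : ℕ → ℍ[ℝ], (∀ x : ℝ, |x| < 1 → HasSum (fun n => x ^ n • c n) (g x)) →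
      HasFPowerSeriesAt g (fun n => ContinuousMultilinearMap.mkPiRing ℝ (Fin n) (c n)) 0 := by
    intro c hc
    refine hasFPowerSeriesAt_iff.2 ?_
    filter_upwards [Metric.ball_mem_nhds (0 : ℝ) one_pos] with x hx
    simpa [FormalMultilinearSeries.coeff] using hc x (by simpa using hx)
  have h := (key a ha).eq_formalMultilinearSeries (key b hb)
  funext n
  simpa [FormalMultilinearSeries.coeff] using congrArg (fun p => FormalMultilinearSeries.coeff p n) h

/-- A slice regular function on the unit ball is the sum of a power series with coefficients on
the right. -/
theorem IsSliceRegularOn.exists_hasSum {f : ℍ[ℝ] → ℍ[ℝ]} (hf : IsSliceRegularOn f unitBall) :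
    ∃ a : ℕ → ℍ[ℝ], ∀ q : ℍ[ℝ], ‖q‖ < 1 → HasSum (fun n => q ^ n * a n) (f q) := by
  choose! a ha using fun I (hI : I ∈ imaginaryUnits) => exists_hasSum_slice hf hI
  have hreal : ∀ I ∈ imaginaryUnits, ∀ x : ℝ, |x| < 1 →
      HasSum (fun n => x ^ n • a I n) (f (x : ℍ[ℝ])) := by
    intro I hI x hx
    have h := ha I hI (x : ℂ) (by simpa using hx)
    have h2 : sliceMap I (x : ℂ) = (x : ℍ[ℝ]) := by simp [sliceMap]
    simp only [h2, ← Quaternion.coe_pow, Quaternion.coe_mul_eq_smul] at h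
    exact h
  obtain ⟨J, hJ, -⟩ := exists_sliceMap_eq 0
  refine ⟨a J, fun q hq => ?_⟩
  obtain ⟨I, hI, z, rfl⟩ := exists_sliceMap_eq q
  rw [coeff_unique (hreal J hJ) (hreal I hI)]
  refine ha I hI z ?_
  rwa [← sliceHom_apply hI, norm_sliceHom] at hq

/-! ### Pointwise contraction and Parseval's identity. -/

/-- If `P + I Q` lies in the closed unit ball for every imaginary unit `I`, then left multiplication
by `P + i Q` is a contraction of `ℍ ⊗ ℂ`. -/
theorem norm_sq_complexified_mul_le {P Q : ℍ[ℝ]}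
    (h : ∀ I ∈ imaginaryUnits, ‖P + I * Q‖ ≤ 1) (α β : ℍ[ℝ]) :
    ‖P * α - Q * β‖ ^ 2 + ‖P * β + Q * α‖ ^ 2 ≤ ‖α‖ ^ 2 + ‖β‖ ^ 2 := by
  have hsq : ∀ q : ℍ[ℝ], ‖q‖ ^ 2 = q.re ^ 2 + q.imI ^ 2 + q.imJ ^ 2 + q.imK ^ 2 := fun q => by
    rw [sq, ← Quaternion.normSq_eq_norm_mul_self, Quaternion.normSq_def']
  set W := (P * star Q).im with hW
  set V := (star Q * P).im with hV
  set T := (β * star α).im with hT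
  -- The unit along `W` maximises `‖P + I * Q‖`, which extracts the full strength of `h`.
  obtain ⟨I, hI, hWI⟩ := exists_imaginaryUnit_norm_smul_eq (w := W) (by simp [hW])
  have hre : I.re = 0 := by
    have := congrArg (fun q : ℍ[ℝ] => q.re) (star_of_mem_imaginaryUnits hI)
    simp only [Quaternion.re_star, Quaternion.re_neg] at this
    linarith
  have hIn := norm_of_mem_imaginaryUnits hI
  have hbound : ‖P‖ ^ 2 + ‖Q‖ ^ 2 + 2 * ‖W‖ ≤ 1 := by
    have h1 : ‖P + I * Q‖ ^ 2 ≤ 1 := by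
      have := h I hI
      nlinarith [norm_nonneg (P + I * Q)]
    have h2 : ‖P + I * Q‖ ^ 2 = ‖P‖ ^ 2 + ‖I * Q‖ ^ 2 + 2 * inner ℝ W I := by
      rw [Quaternion.inner_def, hsq, hsq P, hsq (I * Q), hW]
      simp [hre]
      ring
    have h3 : inner ℝ W I = ‖W‖ := by
      rw [hWI, real_inner_smul_left, real_inner_self_eq_norm_sq, hIn, ← hWI]
      simp
    rw [h2, h3, norm_mul, hIn, one_mul] at h1
    exact h1
  -- `P * star Q` and `star Q * P` have equal norms and equal real parts.
  have hVW : ‖V‖ = ‖W‖ := by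
    refine (pow_left_inj₀ (norm_nonneg _) (norm_nonneg _) two_ne_zero).1 ?_
    rw [hsq, hsq, hV, hW]
    simp
    ring
  have hTn : ‖T‖ ≤ ‖β‖ * ‖α‖ := by
    rw [← Quaternion.norm_star α, ← norm_mul]
    refine (sq_le_sq₀ (norm_nonneg _) (norm_nonneg _)).1 ?_
    rw [hsq, hsq, hT]
    simp
    positivity
  have hid : ‖P * α - Q * β‖ ^ 2 + ‖P * β + Q * α‖ ^ 2
      = (‖P‖ ^ 2 + ‖Q‖ ^ 2) * (‖α‖ ^ 2 + ‖β‖ ^ 2) - 4 * inner ℝ V T := by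
    rw [Quaternion.inner_def]
    simp only [hsq, hV, hT]
    simp
    ring
  have hcs : -(‖V‖ * ‖T‖) ≤ inner ℝ V T := neg_le_of_abs_le (abs_real_inner_le_norm V T)
  have h5 : ‖V‖ * ‖T‖ ≤ ‖W‖ * (‖β‖ * ‖α‖) := by
    rw [hVW]; exact mul_le_mul_of_nonneg_left hTn (norm_nonneg _)
  have h6 : 0 ≤ ‖W‖ * (‖α‖ - ‖β‖) ^ 2 := by positivity
  have h7 := mul_le_mul_of_nonneg_right hbound
    (add_nonneg (sq_nonneg ‖α‖) (sq_nonneg ‖β‖))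
  rw [hid]
  nlinarith

theorem hasSum_inner {E : Type*} [NormedAddCommGroup E] [InnerProductSpace ℝ E] [CompleteSpace E]
    {x y : ℕ → E} (hx : Summable fun n => ‖x n‖) (hy : Summable fun n => ‖y n‖) :
    HasSum (fun p : ℕ × ℕ => inner ℝ (x p.1) (y p.2)) (inner ℝ (∑' n, x n) (∑' n, y n)) := by
  have hs : Summable fun p : ℕ × ℕ => inner ℝ (x p.1) (y p.2) :=
    Summable.of_norm_bounded (hx.mul_of_nonneg hy (fun _ => norm_nonneg _) fun _ => norm_nonneg _)
      fun p => norm_inner_le_norm _ _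
  have h1 : ∀ n, HasSum (fun m => inner ℝ (x n) (y m)) (inner ℝ (x n) (∑' m, y m)) := fun n =>
    (innerSL ℝ (x n)).hasSum hy.of_norm.hasSum
  have h2 : HasSum (fun n => inner ℝ (x n) (∑' m, y m)) (inner ℝ (∑' n, x n) (∑' m, y m)) := by
    have := (innerSL ℝ (∑' m, y m)).hasSum hx.of_norm.hasSum
    simpa [real_inner_comm] using this
  rw [← (hs.hasSum.prod_fiberwise h1).unique h2]
  exact hs.hasSum

theorem integral_cos_int_mul {k : ℤ} (hk : k ≠ 0) :
    ∫ θ in (0 : ℝ)..2 * Real.pi, Real.cos (k * θ) = 0 := by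
  have hk' : (k : ℝ) ≠ 0 := by exact_mod_cast hk
  rw [intervalIntegral.integral_comp_mul_left _ hk', integral_cos,
    show (k : ℝ) * (2 * Real.pi) = ((2 * k : ℤ) : ℝ) * Real.pi by push_cast; ring,
    Real.sin_int_mul_pi]
  simp

section Trigonometric

variable {E : Type*} [NormedAddCommGroup E] [InnerProductSpace ℝ E]

theorem norm_cos_smul_le (x : ℝ) (v : E) : ‖Real.cos x • v‖ ≤ ‖v‖ := by
  rw [norm_smul]
  exact mul_le_of_le_one_left (norm_nonneg _) (Real.abs_cos_le_one x)

theorem norm_sin_smul_le (x : ℝ) (v : E) : ‖Real.sin x • v‖ ≤ ‖v‖ := by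
  rw [norm_smul]
  exact mul_le_of_le_one_left (norm_nonneg _) (Real.abs_sin_le_one x)

theorem summable_norm_cos_smul {c : ℕ → E} (hc : Summable fun n => ‖c n‖) (θ : ℝ) :
    Summable fun n : ℕ => ‖Real.cos (n * θ) • c n‖ :=
  hc.of_nonneg_of_le (fun _ => norm_nonneg _) fun _ => norm_cos_smul_le _ _

theorem summable_norm_sin_smul {c : ℕ → E} (hc : Summable fun n => ‖c n‖) (θ : ℝ) :
    Summable fun n : ℕ => ‖Real.sin (n * θ) • c n‖ :=
  hc.of_nonneg_of_le (fun _ => norm_nonneg _) fun _ => norm_sin_smul_le _ _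

variable [CompleteSpace E]

theorem continuous_tsum_cos_smul {c : ℕ → E} (hc : Summable fun n => ‖c n‖) :
    Continuous fun θ : ℝ => ∑' n : ℕ, Real.cos (n * θ) • c n :=
  continuous_tsum (fun n => by fun_prop) hc fun _ _ => norm_cos_smul_le _ _

theorem continuous_tsum_sin_smul {c : ℕ → E} (hc : Summable fun n => ‖c n‖) :
    Continuous fun θ : ℝ => ∑' n : ℕ, Real.sin (n * θ) • c n :=
  continuous_tsum (fun n => by fun_prop) hc fun _ _ => norm_sin_smul_le _ _

/-- Parseval's identity for an absolutely convergent series `∑ exp (i n θ) c n`. -/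
theorem hasSum_parseval {c : ℕ → E} (hc : Summable fun n => ‖c n‖) :
    HasSum (fun n => 2 * Real.pi * ‖c n‖ ^ 2)
      (∫ θ in (0 : ℝ)..2 * Real.pi, (‖∑' n : ℕ, Real.cos (n * θ) • c n‖ ^ 2
        + ‖∑' n : ℕ, Real.sin (n * θ) • c n‖ ^ 2)) := by
  have hpt : ∀ θ : ℝ, HasSum
      (fun p : ℕ × ℕ => Real.cos (((p.1 : ℤ) - (p.2 : ℤ) : ℤ) * θ) * inner ℝ (c p.1) (c p.2))
      (‖∑' n : ℕ, Real.cos (n * θ) • c n‖ ^ 2 + ‖∑' n : ℕ, Real.sin (n * θ) • c n‖ ^ 2) := by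
    intro θ
    have h := (hasSum_inner (summable_norm_cos_smul hc θ) (summable_norm_cos_smul hc θ)).add
      (hasSum_inner (summable_norm_sin_smul hc θ) (summable_norm_sin_smul hc θ))
    rw [real_inner_self_eq_norm_sq, real_inner_self_eq_norm_sq] at h
    have e : (fun p : ℕ × ℕ =>
        Real.cos (((p.1 : ℤ) - (p.2 : ℤ) : ℤ) * θ) * inner ℝ (c p.1) (c p.2)) = fun p =>
        inner ℝ (Real.cos (p.1 * θ) • c p.1) (Real.cos (p.2 * θ) • c p.2)
        + inner ℝ (Real.sin (p.1 * θ) • c p.1) (Real.sin (p.2 * θ) • c p.2) := by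
      funext p
      simp only [real_inner_smul_left, real_inner_smul_right]
      push_cast
      rw [sub_mul, Real.cos_sub]
      ring
    rw [e]
    exact h
  have hsum : Summable fun p : ℕ × ℕ => ‖c p.1‖ * ‖c p.2‖ :=
    hc.mul_of_nonneg hc (fun _ => norm_nonneg _) fun _ => norm_nonneg _
  have h := intervalIntegral.hasSum_integral_of_dominated_convergence (a := 0) (b := 2 * Real.pi)
    (μ := MeasureTheory.volume)
    (F := fun (p : ℕ × ℕ) (θ : ℝ) =>
      Real.cos (((p.1 : ℤ) - (p.2 : ℤ) : ℤ) * θ) * inner ℝ (c p.1) (c p.2))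
    (fun p _ => ‖c p.1‖ * ‖c p.2‖)
    (fun p => (by fun_prop : Continuous _).aestronglyMeasurable)
    (fun p => Eventually.of_forall fun θ _ => by
      rw [norm_mul]
      exact (mul_le_of_le_one_left (norm_nonneg _) (Real.abs_cos_le_one _)).trans
        (norm_inner_le_norm _ _))
    (Eventually.of_forall fun _ _ => hsum) (by simp)
    (Eventually.of_forall fun θ _ => hpt θ)
  have hinj : Function.Injective fun n : ℕ => (n, n) := fun a b h => congrArg Prod.fst h
  -- Only the diagonal terms survive integration.
  rw [← hinj.hasSum_iff] at h
  · have e : (fun n => 2 * Real.pi * ‖c n‖ ^ 2) = ((fun p : ℕ × ℕ => ∫ θ in (0 : ℝ)..2 * Real.pi,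
        Real.cos (((p.1 : ℤ) - (p.2 : ℤ) : ℤ) * θ) * inner ℝ (c p.1) (c p.2)) ∘
        fun n : ℕ => (n, n)) := by
      funext n
      simp
    rw [e]
    exact h
  · rintro ⟨n, m⟩ hnm
    have hne : (n : ℤ) - m ≠ 0 := by
      intro h0
      exact hnm ⟨n, by rw [Prod.mk.injEq]; exact ⟨rfl, by omega⟩⟩
    simp only
    rw [intervalIntegral.integral_mul_const, integral_cos_int_mul hne, zero_mul]

end Trigonometric

/-! ### The regular product as a contraction. -/

/-- The sequence of coefficients of the regular product of two power series. -/
noncomputable def conv (a b : ℕ → ℍ[ℝ]) (n : ℕ) : ℍ[ℝ] := ∑ kl ∈ antidiagonal n, a kl.1 * b kl.2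

theorem summable_norm_conv {a b : ℕ → ℍ[ℝ]} (ha : Summable fun n => ‖a n‖)
    (hb : Summable fun n => ‖b n‖) : Summable fun n => ‖conv a b n‖ :=
  summable_norm_sum_mul_antidiagonal_of_summable_norm ha hb

/-- This is the real part of a Cauchy product in `ℍ ⊗ ℂ`, where `exp (i n θ)` is central and so
passes the coefficients. -/
theorem tsum_cos_smul_conv {a b : ℕ → ℍ[ℝ]} (ha : Summable fun n => ‖a n‖)
    (hb : Summable fun n => ‖b n‖) (θ : ℝ) :
    ∑' n : ℕ, Real.cos (n * θ) • conv a b n =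
      (∑' n : ℕ, Real.cos (n * θ) • a n) * (∑' n : ℕ, Real.cos (n * θ) • b n) -
      (∑' n : ℕ, Real.sin (n * θ) • a n) * (∑' n : ℕ, Real.sin (n * θ) • b n) := by
  have hac := summable_norm_cos_smul ha θ
  have has := summable_norm_sin_smul ha θ
  have hbc := summable_norm_cos_smul hb θ
  have hbs := summable_norm_sin_smul hb θ
  rw [tsum_mul_tsum_eq_tsum_sum_antidiagonal_of_summable_norm hac hbc,
    tsum_mul_tsum_eq_tsum_sum_antidiagonal_of_summable_norm has hbs,
    ← (summable_norm_sum_mul_antidiagonal_of_summable_norm hac hbc).of_norm.tsum_sub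
      (summable_norm_sum_mul_antidiagonal_of_summable_norm has hbs).of_norm]
  refine tsum_congr fun n => ?_
  rw [conv, smul_sum, ← sum_sub_distrib]
  refine sum_congr rfl fun p hp => ?_
  rw [← mem_antidiagonal.1 hp]
  push_cast
  rw [add_mul, Real.cos_add, smul_mul_smul_comm, smul_mul_smul_comm, sub_smul]

theorem tsum_sin_smul_conv {a b : ℕ → ℍ[ℝ]} (ha : Summable fun n => ‖a n‖)
    (hb : Summable fun n => ‖b n‖) (θ : ℝ) :
    ∑' n : ℕ, Real.sin (n * θ) • conv a b n =
      (∑' n : ℕ, Real.cos (n * θ) • a n) * (∑' n : ℕ, Real.sin (n * θ) • b n) +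
      (∑' n : ℕ, Real.sin (n * θ) • a n) * (∑' n : ℕ, Real.cos (n * θ) • b n) := by
  have hac := summable_norm_cos_smul ha θ
  have has := summable_norm_sin_smul ha θ
  have hbc := summable_norm_cos_smul hb θ
  have hbs := summable_norm_sin_smul hb θ
  rw [tsum_mul_tsum_eq_tsum_sum_antidiagonal_of_summable_norm hac hbs,
    tsum_mul_tsum_eq_tsum_sum_antidiagonal_of_summable_norm has hbc,
    ← (summable_norm_sum_mul_antidiagonal_of_summable_norm hac hbs).of_norm.tsum_add
      (summable_norm_sum_mul_antidiagonal_of_summable_norm has hbc).of_norm]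
  refine tsum_congr fun n => ?_
  rw [conv, smul_sum, ← sum_add_distrib]
  refine sum_congr rfl fun p hp => ?_
  rw [← mem_antidiagonal.1 hp]
  push_cast
  rw [add_mul, Real.sin_add, smul_mul_smul_comm, smul_mul_smul_comm, ← add_smul, add_comm]

/-- Parseval turns the pointwise contraction on the circle into one on coefficients. -/
theorem tsum_norm_sq_conv_le {a b : ℕ → ℍ[ℝ]} (ha : Summable fun n => ‖a n‖)
    (hb : Summable fun n => ‖b n‖)
    (h : ∀ θ : ℝ, ∀ I ∈ imaginaryUnits,
      ‖∑' n : ℕ, Real.cos (n * θ) • a n + I * ∑' n : ℕ, Real.sin (n * θ) • a n‖ ≤ 1) :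
    ∑' n, ‖conv a b n‖ ^ 2 ≤ ∑' n, ‖b n‖ ^ 2 := by
  have hc := summable_norm_conv ha hb
  have h2 : ∑' n, 2 * Real.pi * ‖conv a b n‖ ^ 2 ≤ ∑' n, 2 * Real.pi * ‖b n‖ ^ 2 := by
    rw [(hasSum_parseval hc).tsum_eq, (hasSum_parseval hb).tsum_eq]
    refine intervalIntegral.integral_mono_on (by positivity)
      (Continuous.intervalIntegrable (((continuous_tsum_cos_smul hc).norm.pow 2).add
        ((continuous_tsum_sin_smul hc).norm.pow 2)) _ _)
      (Continuous.intervalIntegrable (((continuous_tsum_cos_smul hb).norm.pow 2).add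
        ((continuous_tsum_sin_smul hb).norm.pow 2)) _ _) fun θ _ => ?_
    rw [tsum_cos_smul_conv ha hb, tsum_sin_smul_conv ha hb]
    exact norm_sq_complexified_mul_le (h θ) _ _
  rw [tsum_mul_left, tsum_mul_left] at h2
  exact le_of_mul_le_mul_left h2 (by positivity)

theorem summable_norm_sq {b : ℕ → ℍ[ℝ]} (hb : Summable fun n => ‖b n‖) :
    Summable fun n => ‖b n‖ ^ 2 := by
  refine hb.of_norm_bounded_eventually_nat ?_
  filter_upwards [hb.tendsto_atTop_zero.eventually_le_const one_pos] with n hn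
  rw [norm_pow, norm_norm, sq]
  exact mul_le_of_le_one_left (norm_nonneg _) hn

theorem conv_pow_smul (a b : ℕ → ℍ[ℝ]) (r : ℝ) (n : ℕ) :
    conv (fun n => r ^ n • a n) (fun n => r ^ n • b n) n = r ^ n • conv a b n := by
  rw [conv, conv, smul_sum]
  refine sum_congr rfl fun p hp => ?_
  rw [← mem_antidiagonal.1 hp, smul_mul_smul_comm, pow_add]

theorem summable_norm_coeff {f : ℍ[ℝ] → ℍ[ℝ]} {a : ℕ → ℍ[ℝ]}
    (ha : ∀ q : ℍ[ℝ], ‖q‖ < 1 → HasSum (fun n => q ^ n * a n) (f q)) {r : ℝ} (h0 : 0 ≤ r)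
    (h1 : r < 1) : Summable fun n => ‖r ^ n • a n‖ := by
  have h := ha (r : ℍ[ℝ]) (by rwa [Quaternion.norm_coe, Real.norm_of_nonneg h0])
  simp only [← Quaternion.coe_pow, Quaternion.coe_mul_eq_smul] at h
  exact summable_norm_iff.2 h.summable

theorem sliceHom_polar_pow {I : ℍ[ℝ]} (hI : I ∈ imaginaryUnits) (r θ : ℝ) (n : ℕ) :
    sliceHom hI (r * Complex.exp (θ * Complex.I)) ^ n =
      r ^ n • (((Real.cos (n * θ) : ℝ) : ℍ[ℝ]) + I * ((Real.sin (n * θ) : ℝ) : ℍ[ℝ])) := by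
  have h : ((r : ℂ) * Complex.exp (θ * Complex.I)) ^ n =
      (r ^ n : ℝ) • Complex.exp ((n * θ : ℝ) * Complex.I) := by
    rw [mul_pow, ← Complex.exp_nat_mul, Complex.real_smul]
    push_cast
    ring_nf
  rw [← map_pow, h, map_smul, sliceHom_apply, sliceMap, Complex.exp_ofReal_mul_I_re,
    Complex.exp_ofReal_mul_I_im]

/-- Regular multiplication by a slice regular function bounded by one is a contraction of the
space of square summable coefficients. -/
theorem sum_norm_sq_conv_le {f : ℍ[ℝ] → ℍ[ℝ]} {a b : ℕ → ℍ[ℝ]}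
    (ha : ∀ q : ℍ[ℝ], ‖q‖ < 1 → HasSum (fun n => q ^ n * a n) (f q))
    (hf : ∀ q : ℍ[ℝ], ‖q‖ < 1 → ‖f q‖ ≤ 1) (hb : Summable fun n => ‖b n‖) (N : ℕ) :
    ∑ n ∈ range N, ‖conv a b n‖ ^ 2 ≤ ∑' n, ‖b n‖ ^ 2 := by
  have hb2 := summable_norm_sq hb
  -- Radius `r < 1` makes the coefficients of `f` absolutely summable; finite partial sums then pass
  -- to the limit `r → 1`.
  have key : ∀ r : ℝ, 0 ≤ r → r < 1 →
      ∑ n ∈ range N, ‖r ^ n • conv a b n‖ ^ 2 ≤ ∑' n, ‖b n‖ ^ 2 := by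
    intro r h0 h1
    have har := summable_norm_coeff ha h0 h1
    have hle : ∀ n, ‖r ^ n • b n‖ ≤ ‖b n‖ := fun n => by
      rw [norm_smul, norm_pow, Real.norm_of_nonneg h0]
      exact mul_le_of_le_one_left (norm_nonneg _) (pow_le_one₀ h0 h1.le)
    have hbr : Summable fun n => ‖r ^ n • b n‖ := hb.of_nonneg_of_le (fun _ => norm_nonneg _) hle
    have hmain := tsum_norm_sq_conv_le har hbr fun θ I hI => by
      set z : ℂ := r * Complex.exp (θ * Complex.I) with hz
      have hzn : ‖sliceHom hI z‖ < 1 := by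
        rw [norm_sliceHom, hz, norm_mul, Complex.norm_exp_ofReal_mul_I, mul_one]
        simpa [abs_of_nonneg h0] using h1
      have hs := (summable_norm_cos_smul har θ).of_norm.hasSum.add
        ((summable_norm_sin_smul har θ).of_norm.hasSum.mul_left I)
      have e : (fun n => sliceHom hI z ^ n * a n) = fun n : ℕ =>
          Real.cos (n * θ) • r ^ n • a n + I * Real.sin (n * θ) • r ^ n • a n := by
        funext n
        rw [hz, sliceHom_polar_pow, smul_mul_assoc, add_mul, Quaternion.coe_mul_eq_smul, mul_assoc,
          Quaternion.coe_mul_eq_smul, smul_add]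
        simp only [mul_smul_comm]
        rw [smul_comm (r ^ n) (Real.cos _), smul_comm (r ^ n) (Real.sin _)]
      have hs2 := ha _ hzn
      rw [e] at hs2
      rw [← hs2.unique hs]
      exact hf _ hzn
    simp only [conv_pow_smul] at hmain
    have hcs : Summable fun n => ‖r ^ n • conv a b n‖ ^ 2 := by
      have := summable_norm_conv har hbr
      simp only [conv_pow_smul] at this
      exact summable_norm_sq this
    refine (hcs.sum_le_tsum _ fun _ _ => sq_nonneg _).trans (hmain.trans ?_)
    exact (summable_norm_sq hbr).tsum_le_tsum
      (fun n => pow_le_pow_left₀ (norm_nonneg _) (hle n) 2) hb2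
  have hcont : Continuous fun r : ℝ => ∑ n ∈ range N, ‖r ^ n • conv a b n‖ ^ 2 := by fun_prop
  have hlim : Tendsto (fun r : ℝ => ∑ n ∈ range N, ‖r ^ n • conv a b n‖ ^ 2) (𝓝[<] 1)
      (𝓝 (∑ n ∈ range N, ‖conv a b n‖ ^ 2)) := by
    have := (hcont.tendsto 1).mono_left (nhdsWithin_le_nhds (s := Set.Iio 1))
    simpa using this
  refine le_of_tendsto hlim ?_
  filter_upwards [Ioo_mem_nhdsLT (zero_lt_one' ℝ)] with r hr
  exact key r hr.1.le hr.2

/-! ### Evaluation at fixed points and the equality case. -/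

theorem summable_norm_pow {p : ℍ[ℝ]} (hp : ‖p‖ < 1) : Summable fun n => ‖p ^ n‖ := by
  simpa using summable_geometric_of_lt_one (norm_nonneg p) hp

theorem hasSum_sum_antidiagonal {E : Type*} [NormedAddCommGroup E] {g : ℕ × ℕ → E} {s : E}
    (hg : HasSum g s) : HasSum (fun n => ∑ x ∈ antidiagonal n, g x) s := by
  have h : HasSum (fun x : Σ n : ℕ, antidiagonal n => g x.2) s :=
    HasAntidiagonal.sigmaAntidiagonalEquivProd.hasSum_iff.2 hg
  exact h.sigma fun n => (antidiagonal n).hasSum g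

/-- The regular product of two power series evaluated at `p`. -/
theorem hasSum_pow_mul_conv {f : ℍ[ℝ] → ℍ[ℝ]} {a u : ℕ → ℍ[ℝ]}
    (ha : ∀ q : ℍ[ℝ], ‖q‖ < 1 → HasSum (fun n => q ^ n * a n) (f q))
    (hu : Summable fun n => ‖u n‖) {p : ℍ[ℝ]} (hp : ‖p‖ < 1) :
    HasSum (fun n => p ^ n * conv a u n) (∑' m, p ^ m * f p * u m) := by
  set g : ℕ × ℕ → ℍ[ℝ] := fun x => p ^ (x.1 + x.2) * (a x.1 * u x.2) with hg
  have hpa : Summable fun n => ‖p ^ n * a n‖ := summable_norm_iff.2 (ha p hp).summable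
  have hgs : Summable g := by
    refine Summable.of_norm_bounded
      (hpa.mul_of_nonneg hu (fun _ => norm_nonneg _) fun _ => norm_nonneg _) fun x => ?_
    simp only [hg, norm_mul, norm_pow]
    rw [← mul_assoc]
    refine mul_le_mul_of_nonneg_right ?_ (norm_nonneg _)
    refine mul_le_mul_of_nonneg_right ?_ (norm_nonneg _)
    exact pow_le_pow_of_le_one (norm_nonneg _) hp.le (Nat.le_add_right _ _)
  -- Summing over the index of `a` first produces `f p`; the swap makes that index the inner one.
  have h1 : HasSum (fun m => p ^ m * f p * u m) (∑' x, g x) := by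
    refine HasSum.prod_fiberwise (f := fun x : ℕ × ℕ => g x.swap)
      ((Equiv.prodComm ℕ ℕ).hasSum_iff.2 hgs.hasSum) fun m => ?_
    have h := ((ha p hp).mul_left (p ^ m)).mul_right (u m)
    have e : (fun k => g (Prod.swap (m, k))) = fun k => p ^ m * (p ^ k * a k) * u m := by
      funext k
      simp only [hg, Prod.swap]
      rw [add_comm, pow_add]
      simp only [mul_assoc]
    exact e ▸ h
  rw [h1.tsum_eq]
  have h3 : ∀ n, p ^ n * conv a u n = ∑ x ∈ antidiagonal n, g x := fun n => by
    rw [conv, mul_sum]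
    refine sum_congr rfl fun x hx => ?_
    rw [hg, ← mem_antidiagonal.1 hx]
  simp only [h3]
  exact hasSum_sum_antidiagonal hgs.hasSum

/-- Expanding the square, `‖h - c‖² = s - 2 * s + ‖c‖² ≤ 0`. -/
theorem eq_of_tsum_inner_eq {E : Type*} [NormedAddCommGroup E] [InnerProductSpace ℝ E]
    {c h : ℕ → E} {s : ℝ} (hc : ∀ N, ∑ n ∈ range N, ‖c n‖ ^ 2 ≤ s)
    (hh : HasSum (fun n => ‖h n‖ ^ 2) s) (hi : HasSum (fun n => inner ℝ (h n) (c n)) s) :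
    c = h := by
  have hcs : Summable fun n => ‖c n‖ ^ 2 := summable_of_sum_range_le (fun _ => sq_nonneg _) hc
  have hcle : ∑' n, ‖c n‖ ^ 2 ≤ s := Real.tsum_le_of_sum_range_le (fun _ => sq_nonneg _) hc
  have hd : HasSum (fun n => ‖h n - c n‖ ^ 2) (s - 2 * s + ∑' n, ‖c n‖ ^ 2) := by
    have := (hh.sub (hi.mul_left 2)).add hcs.hasSum
    simpa only [norm_sub_sq_real] using this
  have h0 : s - 2 * s + ∑' n, ‖c n‖ ^ 2 = 0 :=
    le_antisymm (by linarith) (hd.nonneg fun _ => sq_nonneg _)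
  rw [h0, hasSum_zero_iff_of_nonneg fun _ => sq_nonneg _] at hd
  funext n
  have := congrFun hd n
  simp only [Pi.zero_apply, ne_eq, OfNat.ofNat_ne_zero, not_false_eq_true, pow_eq_zero_iff,
    norm_eq_zero] at this
  exact (sub_eq_zero.1 this).symm

/-- A power series bounded by one on the unit ball with two distinct fixed points is the identity. -/
theorem eq_id_of_two_fixed_points {f : ℍ[ℝ] → ℍ[ℝ]} {a : ℕ → ℍ[ℝ]}
    (ha : ∀ q : ℍ[ℝ], ‖q‖ < 1 → HasSum (fun n => q ^ n * a n) (f q))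
    (hf : ∀ q : ℍ[ℝ], ‖q‖ < 1 → ‖f q‖ ≤ 1) {p q : ℍ[ℝ]} (hp : ‖p‖ < 1) (hq : ‖q‖ < 1)
    (hpq : p ≠ q) (hfp : f p = p) (hfq : f q = q) (x : ℍ[ℝ]) (hx : ‖x‖ < 1) : f x = x := by
  set h : ℕ → ℍ[ℝ] := fun n => star (p ^ n - q ^ n) with hh
  set u : ℕ → ℍ[ℝ] := fun n => h (n + 1) with hu
  have hhs : Summable fun n => ‖h n‖ := by
    refine ((summable_norm_pow hp).add (summable_norm_pow hq)).of_nonneg_of_le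
      (fun _ => norm_nonneg _) fun n => ?_
    rw [hh, Quaternion.norm_star]
    exact norm_sub_le _ _
  have hus : Summable fun n => ‖u n‖ := (summable_nat_add_iff 1).2 hhs
  have hsum : HasSum (fun n => ‖h n‖ ^ 2) (∑' n, ‖u n‖ ^ 2) := by
    have h0 : ‖h 0‖ ^ 2 = 0 := by simp [hh]
    have := (summable_norm_sq hhs).hasSum
    rwa [(summable_norm_sq hhs).tsum_eq_zero_add, h0, zero_add] at this
  have hev : ∀ y : ℍ[ℝ], ‖y‖ < 1 → f y = y →
      HasSum (fun n => y ^ n * conv a u n) (∑' m, y ^ (m + 1) * u m) := by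
    intro y hy hfy
    have := hasSum_pow_mul_conv ha hus hy
    simpa only [hfy, ← pow_succ] using this
  have hys : ∀ y : ℍ[ℝ], ‖y‖ < 1 → Summable fun m => y ^ (m + 1) * u m := by
    intro y hy
    refine Summable.of_norm_bounded hus fun m => ?_
    rw [norm_mul, norm_pow]
    exact mul_le_of_le_one_left (norm_nonneg _) (pow_le_one₀ (norm_nonneg _) hy.le)
  -- Pairing with `1` takes the real part, turning evaluation at `p` minus evaluation at `q` into
  -- the inner product with `h`.
  have hinner : ∀ v w : ℍ[ℝ], inner ℝ (1 : ℍ[ℝ]) (star v * w) = inner ℝ v w := by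
    intro v w
    rw [Quaternion.inner_def, Quaternion.inner_def]
    simp
    ring
  have hi : HasSum (fun n => inner ℝ (h n) (conv a u n)) (∑' n, ‖u n‖ ^ 2) := by
    have h1 := (hev p hp hfp).sub (hev q hq hfq)
    rw [← (hys p hp).tsum_sub (hys q hq)] at h1
    have h2 := (innerSL ℝ (1 : ℍ[ℝ])).hasSum h1
    rw [(innerSL ℝ (1 : ℍ[ℝ])).map_tsum ((hys p hp).sub (hys q hq))] at h2
    have e1 : ∀ m, innerSL ℝ (1 : ℍ[ℝ]) (p ^ (m + 1) * u m - q ^ (m + 1) * u m) = ‖u m‖ ^ 2 := by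
      intro m
      rw [← sub_mul, ← star_star (p ^ (m + 1) - q ^ (m + 1)), innerSL_apply_apply]
      exact (hinner (u m) (u m)).trans (real_inner_self_eq_norm_sq _)
    have e2 : ∀ m, innerSL ℝ (1 : ℍ[ℝ]) (p ^ m * conv a u m - q ^ m * conv a u m)
        = inner ℝ (h m) (conv a u m) := by
      intro m
      rw [← sub_mul, ← star_star (p ^ m - q ^ m), innerSL_apply_apply]
      exact hinner (h m) _
    simpa only [e1, e2] using h2
  have hconv : conv a u = h :=
    eq_of_tsum_inner_eq (sum_norm_sq_conv_le ha hf hus) hsum hi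
  have hps : PowerSeries.mk a * PowerSeries.mk u = PowerSeries.X * PowerSeries.mk u := by
    ext1 n
    rw [PowerSeries.coeff_mul]
    simp only [PowerSeries.coeff_mk]
    refine (congrFun hconv n).trans ?_
    cases n with
    | zero => simp [hh]
    | succ n => rw [PowerSeries.coeff_succ_X_mul, PowerSeries.coeff_mk]
  -- The constant coefficient is `star (p - q)`.
  have hu0 : PowerSeries.mk u ≠ 0 := by
    intro h0
    have := congrArg (PowerSeries.coeff 0) h0
    rw [PowerSeries.coeff_mk] at this
    simp only [hu, hh, zero_add, pow_one, map_zero, star_eq_zero] at this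
    exact hpq (sub_eq_zero.1 this)
  have haX := mul_right_cancel₀ hu0 hps
  have hcoef : ∀ n, a n = if n = 1 then 1 else 0 := fun n => by
    rw [← PowerSeries.coeff_X, ← haX, PowerSeries.coeff_mk]
  have hlast := ha x hx
  refine hlast.unique ?_
  have := hasSum_single (f := fun n => x ^ n * a n) 1 fun n hn => by simp [hcoef, hn]
  simpa [hcoef] using this

end SliceRegular

theorem mainTheorem3 (f : Quaternion ℝ → Quaternion ℝ)
    (hf : SliceRegular.IsSliceRegularOn f SliceRegular.unitBall)
    (hmaps : Set.MapsTo f SliceRegular.unitBall SliceRegular.unitBall)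
    (q₀ : Quaternion ℝ) (hq₀ : q₀ ∈ SliceRegular.unitBall) (hfix : f q₀ = q₀) :
    (∀ q ∈ SliceRegular.unitBall, f q = q) ∨
      (∀ q ∈ SliceRegular.unitBall, f q = q → q = q₀) := by
  obtain ⟨a, ha⟩ := hf.exists_hasSum
  by_cases h : ∀ q ∈ SliceRegular.unitBall, f q = q → q = q₀
  · exact Or.inr h
  · push Not at h
    obtain ⟨q, hq, hfq, hne⟩ := h
    exact Or.inl (SliceRegular.eq_id_of_two_fixed_points ha (fun x hx => (hmaps hx).le) hq hq₀ hne
      hfq hfix)
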